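/- Let $K$ be a field. A $K$-variety is a separated scheme of finite type over $\operatorname{Spec} K$. Let $K_0(\mathrm{Var}_K)$ be the Grothendieck ring of $K$-varieties: the abelian group generated by the isomorphism classes $[X]$ of $K$-varieties, modulo the relations $[X]=[Z]+[X\setminus Z]$ for every $K$-variety $X$ and every closed subvariety $Z\subset X$, with multiplication induced by $[X][Y]=[X\times_K Y]$. Put $\mathbb{L}:=[\mathbb{A}^1_K]$. For integers $d_1,d_2\ge 0$, identify $\mathbb{A}^{d_1}_K\times_K\mathbb{A}^{d_2}_K$, through the non-leading coefficients, with the space of pairs $(u,v)$ of monic polynomials with $\deg u=d_1$ and $\deg v=d_2$, and let $\mathrm{Poly}_1^{(d_1,d_2)}$ be its open subvariety consisting of the points for which the corresponding polynomials $u,v$, which have coefficients in the residue field of the point, have no common root in an algebraic closure of that field. Then in $K_0(\mathrm{Var}_K)$ $$\left[\mathrm{Poly}_1^{(d_1,d_2)}\right]=\begin{cases}\mathbb{L}^{d_1+d_2}-\mathbb{L}^{d_1+d_2-1}, & \text{if } d_1>0 \text{ and } d_2>0,\\ \mathbb{L}^{d_1+d_2}, & \text{if } d_1=0 \text{ or }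 d_2=0.\end{cases}$$ -/

import Mathlib

open CategoryTheory AlgebraicGeometry MonoidalCategory CartesianMonoidalCategory

universe u

noncomputable section

/-- A `K`-variety: a separated scheme of finite type over `Spec K`. -/
structure KVariety (K : Type u) [Field K] where
  toOver : Over (Spec (CommRingCat.of K))
  isSeparated : IsSeparated toOver.hom
  locallyOfFiniteType : LocallyOfFiniteType toOver.hom
  quasiCompact : QuasiCompact toOver.hom

namespace KVariety

variable (K : Type u) [Field K]

attribute [instance] isSeparated locallyOfFiniteType quasiCompact

/-- The point `Spec K`. -/
def point : KVariety K where
  toOver := 𝟙_ (Over (Spec (CommRingCat.of K)))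
  isSeparated := inferInstanceAs (IsSeparated (𝟙 (Spec (CommRingCat.of K))))
  locallyOfFiniteType := inferInstanceAs (LocallyOfFiniteType (𝟙 (Spec (CommRingCat.of K))))
  quasiCompact := inferInstanceAs (QuasiCompact (𝟙 (Spec (CommRingCat.of K))))

variable {K}

/-- The fibre product `X ×_K Y`. -/
def prod (X Y : KVariety K) : KVariety K where
  toOver := X.toOver ⊗ Y.toOver
  isSeparated := by rw [Over.tensorObj_hom]; infer_instance
  locallyOfFiniteType := by rw [Over.tensorObj_hom]; infer_instance
  quasiCompact := by rw [Over.tensorObj_hom]; infer_instance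

variable (K)

/-- Two `K`-varieties are equivalent when they are isomorphic over `K`. -/
instance isoSetoid : Setoid (KVariety K) where
  r X Y := Nonempty (X.toOver ≅ Y.toOver)
  iseqv := ⟨fun _ => ⟨Iso.refl _⟩, fun ⟨e⟩ => ⟨e.symm⟩, fun ⟨e⟩ ⟨f⟩ => ⟨e ≪≫ f⟩⟩

/-- Isomorphism classes of `K`-varieties. -/
def IsoClass : Type (u + 1) := Quotient (isoSetoid K)

variable {K}

/-- The isomorphism class of a `K`-variety. -/
def isoClass (X : KVariety K) : IsoClass K := Quotient.mk _ X

variable (K)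

/-- Isomorphism classes of `K`-varieties form a commutative monoid under `×_K`. -/
instance : CommMonoid (IsoClass K) where
  mul := Quotient.map₂ prod fun _ _ ⟨e⟩ _ _ ⟨f⟩ => ⟨e ⊗ᵢ f⟩
  one := isoClass (point K)
  mul_assoc := by
    rintro ⟨X⟩ ⟨Y⟩ ⟨Z⟩
    exact Quotient.sound ⟨α_ X.toOver Y.toOver Z.toOver⟩
  one_mul := by
    rintro ⟨X⟩
    exact Quotient.sound ⟨λ_ X.toOver⟩
  mul_one := by
    rintro ⟨X⟩
    exact Quotient.sound ⟨ρ_ X.toOver⟩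
  mul_comm := by
    rintro ⟨X⟩ ⟨Y⟩
    exact Quotient.sound ⟨β_ X.toOver Y.toOver⟩

variable {K}

lemma isoClass_mul (X Y : KVariety K) : isoClass X * isoClass Y = isoClass (X.prod Y) := rfl

/-- `(Z, U)` is a scissor decomposition of `X`: there are a closed immersion `i : Z ⟶ X` and an open
immersion `j : U ⟶ X` over `K` such that the image of `j` is the complement of the image of `i`,
in other words `U` is the open subscheme `X - Z`. -/
def IsScissor (X Z U : KVariety K) : Prop :=
  ∃ (i : Z.toOver ⟶ X.toOver) (j : U.toOver ⟶ X.toOver),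
    IsClosedImmersion i.left ∧ IsOpenImmersion j.left ∧
      Set.range j.left = (Set.range i.left)ᶜ

lemma isPullback_whiskerRight {S : Scheme.{u}} {Z X : Over S} (f : Z ⟶ X) (Y : Over S) :
    IsPullback (f ▷ Y).left (Limits.pullback.fst Z.hom Y.hom) (Limits.pullback.fst X.hom Y.hom)
      f.left := by
  refine IsPullback.of_right (h₁₂ := Limits.pullback.snd X.hom Y.hom) (h₂₂ := X.hom)
    (v₁₃ := Y.hom) ?_ (Over.whiskerRight_left_fst f) (IsPullback.of_hasPullback _ _).flip
  rw [Over.whiskerRight_left_snd, Over.w]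
  exact (IsPullback.of_hasPullback _ _).flip

lemma range_whiskerRight {S : Scheme.{u}} {Z X : Over S} (f : Z ⟶ X) (Y : Over S) :
    Set.range (f ▷ Y).left = Limits.pullback.fst X.hom Y.hom ⁻¹' Set.range f.left := by
  rw [Over.whiskerRight_left, Scheme.Pullback.range_map]
  simp

lemma IsScissor.prod {X Z U : KVariety K} (h : IsScissor X Z U) (Y : KVariety K) :
    IsScissor (X.prod Y) (Z.prod Y) (U.prod Y) := by
  obtain ⟨i, j, hi, hj, hij⟩ := h
  refine ⟨i ▷ Y.toOver, j ▷ Y.toOver,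
    MorphismProperty.of_isPullback (isPullback_whiskerRight i Y.toOver).flip hi,
    MorphismProperty.of_isPullback (isPullback_whiskerRight j Y.toOver).flip hj, ?_⟩
  erw [range_whiskerRight, range_whiskerRight, hij]
  rfl

variable (K)

/-- The elements `[X] - [Z] - [X - Z]`. -/
def scissorRelations : Set (FreeAbelianGroup (IsoClass K)) :=
  {r | ∃ X Z U : KVariety K, IsScissor X Z U ∧
    r = FreeAbelianGroup.of (isoClass X) - FreeAbelianGroup.of (isoClass Z) -
      FreeAbelianGroup.of (isoClass U)}

/-- The additive subgroup generated by the scissor relations; it is stable under products, hence an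
ideal of the ring whose multiplication is induced by `[X][Y] = [X ×_K Y]`. -/
def scissorIdeal : Ideal (FreeAbelianGroup (IsoClass K)) where
  __ := AddSubgroup.closure (scissorRelations K)
  smul_mem' := by
    intro c x hx
    change c * x ∈ AddSubgroup.closure (scissorRelations K)
    change x ∈ AddSubgroup.closure (scissorRelations K) at hx
    induction c using FreeAbelianGroup.induction_on with
    | zero => simp
    | of c =>
      induction hx using AddSubgroup.closure_induction with
      | mem x hx =>
        obtain ⟨X, Z, U, h, rfl⟩ := hx
        obtain ⟨Y, rfl⟩ : ∃ Y, isoClass Y = c := Quotient.exists_rep c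
        refine AddSubgroup.subset_closure ⟨_, _, _, h.prod Y, ?_⟩
        rw [← isoClass_mul, ← isoClass_mul, ← isoClass_mul, mul_sub, mul_sub]
        simp only [FreeAbelianGroup.of_mul, mul_comm]
      | zero => simp
      | add x y _ _ hx hy => rw [mul_add]; exact add_mem hx hy
      | neg x _ hx => rw [mul_neg]; exact neg_mem hx
    | neg c hc => rw [neg_mul]; exact neg_mem hc
    | add a b ha hb => rw [add_mul]; exact add_mem ha hb

end KVariety

/-- The Grothendieck ring `K₀(Var_K)`: the free abelian group on isomorphism classes of
`K`-varieties modulo the scissor relations, with multiplication induced by `×_K`. -/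
abbrev K0Var (K : Type u) [Field K] : Type (u + 1) :=
  FreeAbelianGroup (KVariety.IsoClass K) ⧸ KVariety.scissorIdeal K

/-- The class `[X]` in `K₀(Var_K)`. -/
def KVariety.motive {K : Type u} [Field K] (X : KVariety K) : K0Var K :=
  Ideal.Quotient.mk (KVariety.scissorIdeal K) (FreeAbelianGroup.of X.isoClass)

/-- The affine line over `K`. -/
def affineLine (K : Type u) [Field K] : KVariety K where
  toOver := Over.mk (Spec.map (CommRingCat.ofHom (algebraMap K (Polynomial K))))
  isSeparated := by dsimp; infer_instance
  locallyOfFiniteType := by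
    dsimp
    rw [HasRingHomProperty.Spec_iff (P := @LocallyOfFiniteType)]
    exact RingHom.finiteType_algebraMap.mpr inferInstance
  quasiCompact := by dsimp; infer_instance

/-- The Lefschetz motive `𝕃 = [𝔸¹]`. -/
def lefschetz (K : Type u) [Field K] : K0Var K := (affineLine K).motive

namespace MonicPairs

variable (K : Type u) [Field K] (d₁ d₂ : ℕ)

/-- The coordinate ring `K[a₀, …, a_{d₁-1}, b₀, …, b_{d₂-1}]` of the affine space
`𝔸^{d₁} × 𝔸^{d₂}` of pairs of monic polynomials of degrees `d₁` and `d₂`. -/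
abbrev CoeffRing : Type u := MvPolynomial (Fin d₁ ⊕ Fin d₂) K

/-- The universal monic polynomial `z^{d₁} + a_{d₁-1} z^{d₁-1} + ⋯ + a₀`. -/
def univFst : Polynomial (CoeffRing K d₁ d₂) :=
  Polynomial.X ^ d₁ +
    ∑ i : Fin d₁, Polynomial.C (MvPolynomial.X (Sum.inl i)) * Polynomial.X ^ (i : ℕ)

/-- The universal monic polynomial `z^{d₂} + b_{d₂-1} z^{d₂-1} + ⋯ + b₀`. -/
def univSnd : Polynomial (CoeffRing K d₁ d₂) :=
  Polynomial.X ^ d₂ +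
    ∑ i : Fin d₂, Polynomial.C (MvPolynomial.X (Sum.inr i)) * Polynomial.X ^ (i : ℕ)

/-- The points `p` of `𝔸^{d₁} × 𝔸^{d₂}` such that the corresponding pair of monic polynomials over
the residue field `κ(p)` has no common root in an algebraic closure of `κ(p)`. -/
def noCommonRoot : Set (PrimeSpectrum (CoeffRing K d₁ d₂)) :=
  {p | ¬ ∃ t : AlgebraicClosure p.asIdeal.ResidueField,
    Polynomial.aeval t (univFst K d₁ d₂) = 0 ∧ Polynomial.aeval t (univSnd K d₁ d₂) = 0}

lemma univFst_monic : (univFst K d₁ d₂).Monic :=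
  Polynomial.monic_X_pow_add (Polynomial.degree_sum_fin_lt _)

lemma univSnd_monic : (univSnd K d₁ d₂).Monic :=
  Polynomial.monic_X_pow_add (Polynomial.degree_sum_fin_lt _)

lemma isOpen_noCommonRoot : IsOpen (noCommonRoot K d₁ d₂) := by
  convert! (PrimeSpectrum.basicOpen
    (Polynomial.resultant (univFst K d₁ d₂) (univSnd K d₁ d₂))).isOpen using 1
  ext p
  set φ := algebraMap (CoeffRing K d₁ d₂) p.asIdeal.ResidueField with hφ
  have hu := univFst_monic K d₁ d₂
  have hv := univSnd_monic K d₁ d₂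
  have h := Polynomial.isCoprime_iff_aeval_ne_zero_of_isAlgClosed
    (k := p.asIdeal.ResidueField) (AlgebraicClosure p.asIdeal.ResidueField)
    ((univFst K d₁ d₂).map φ) ((univSnd K d₁ d₂).map φ)
  rw [← Polynomial.isUnit_resultant_iff_isCoprime (hu.map φ), hu.natDegree_map φ,
    hv.natDegree_map φ, Polynomial.resultant_map_map, isUnit_iff_ne_zero, hφ, ne_eq,
    Ideal.algebraMap_residueField_eq_zero] at h
  simp only [Polynomial.aeval_map_algebraMap] at h
  simp only [noCommonRoot, Set.mem_ofPred_eq, not_exists, not_and_or]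
  exact h.symm

/-- `noCommonRoot` as an open subset of the affine space `𝔸^{d₁} × 𝔸^{d₂}` over `K`. -/
def locus : (Spec (CommRingCat.of (CoeffRing K d₁ d₂))).Opens :=
  ⟨noCommonRoot K d₁ d₂, isOpen_noCommonRoot K d₁ d₂⟩

end MonicPairs

/-- `Poly₁^{(d₁,d₂)}`: the open subvariety of `𝔸^{d₁} × 𝔸^{d₂}` of pairs of monic polynomials of
degrees `d₁`, `d₂` without common root. -/
def polyOne (K : Type u) [Field K] (d₁ d₂ : ℕ) : KVariety K where
  toOver := Over.mk ((MonicPairs.locus K d₁ d₂).ι ≫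
    Spec.map (CommRingCat.ofHom (algebraMap K (MonicPairs.CoeffRing K d₁ d₂))))
  isSeparated := by dsimp; infer_instance
  locallyOfFiniteType := by
    have : LocallyOfFiniteType (Spec.map (CommRingCat.ofHom
        (algebraMap K (MonicPairs.CoeffRing K d₁ d₂)))) := by
      rw [HasRingHomProperty.Spec_iff (P := @LocallyOfFiniteType)]
      exact RingHom.finiteType_algebraMap.mpr inferInstance
    exact locallyOfFiniteType_comp _ _
  quasiCompact := by dsimp; infer_instance

end

open scoped TensorProduct Polynomial

noncomputable section

/-! ### Classes of affine varieties in the Grothendieck ring -/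

namespace KVariety

variable {K : Type u} [Field K]

/-! Two monic polynomials over a ring are coprime exactly when their resultant is a unit. So the
variety is affine, and it represents the functor sending a `K`-algebra `R` to the coprime pairs of
monics over `R`. By Yoneda (`HasMotive.unique`), bijections natural in all `K`-algebras, not only in
fields, give equalities of classes. The scissor relation becomes a cut along one coordinate: zero on
the closed part, a unit on the open part.

Write `[m, n]` for the class sought. The geometry is Euclidean division. If `n ≤ m`, replacing `u`
by `r = u - z^(m-n) v` yields coprime pairs `(v, r)` with `deg r < m`
(`hasMotive_coprimeRemainder`). Clearing the top coefficient of `r` by a multiple of `v` splits off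
an affine line, so `[m+1, n] = 𝕃 [m, n]` (`motive_polyOne_succ`); everything reduces to the
diagonal.

For `m = n > 0`, stratify by the degree `i < n` of `r`. Dividing by the leading coefficient makes
each stratum a punctured line times a space of coprime monic pairs, so `[n, n] = (𝕃 - 1) ∑_{i<n} [n,
i]` (`HasMotive.coprimeRemainder_eq_sum`). By induction the sum telescopes to `𝕃^(2n-1)`
(`motive_polyOne_self`). Symmetry in `u` and `v` covers the other order of degrees. -/

lemma motive_eq_of_iso {X Y : KVariety K} (e : X.toOver ≅ Y.toOver) : X.motive = Y.motive := by
  have : X.isoClass = Y.isoClass := Quotient.sound ⟨e⟩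
  rw [motive, motive, this]

lemma motive_prod (X Y : KVariety K) : (X.prod Y).motive = X.motive * Y.motive := by
  rw [motive, motive, motive, ← isoClass_mul, FreeAbelianGroup.of_mul, map_mul]

lemma motive_point : (point K).motive = 1 := by
  have : FreeAbelianGroup.of (point K).isoClass = (1 : FreeAbelianGroup (IsoClass K)) := rfl
  rw [motive, this, map_one]

lemma IsScissor.motive_eq {X Z U : KVariety K} (h : IsScissor X Z U) :
    X.motive = Z.motive + U.motive := by
  rw [motive, motive, motive, ← map_add, Ideal.Quotient.eq, ← sub_sub]
  exact AddSubgroup.subset_closure ⟨X, Z, U, h, rfl⟩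

variable (K) in
/-- The spectrum of a finitely generated `K`-algebra, as a `K`-variety. -/
def spec (A : Type u) [CommRing A] [Algebra K A] [Algebra.FiniteType K A] : KVariety K where
  toOver := Over.mk (Spec.map (CommRingCat.ofHom (algebraMap K A)))
  isSeparated := by dsimp; infer_instance
  locallyOfFiniteType := by
    dsimp
    rw [HasRingHomProperty.Spec_iff (P := @LocallyOfFiniteType)]
    exact RingHom.finiteType_algebraMap.mpr inferInstance
  quasiCompact := by dsimp; infer_instance

variable {A B : Type u} [CommRing A] [Algebra K A] [Algebra.FiniteType K A]
  [CommRing B] [Algebra K B] [Algebra.FiniteType K B]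

/-- The morphism of spectra induced by a homomorphism of `K`-algebras. -/
def specMap (f : A →ₐ[K] B) : (spec K B).toOver ⟶ (spec K A).toOver :=
  Over.homMk (Spec.map (CommRingCat.ofHom f.toRingHom)) (by
    dsimp [spec]
    rw [← Spec.map_comp, ← CommRingCat.ofHom_comp]
    congr 2
    exact f.comp_algebraMap)

lemma specMap_id : specMap (AlgHom.id K A) = 𝟙 _ := by
  ext1
  exact Spec.map_id (CommRingCat.of A)

lemma specMap_comp {C : Type u} [CommRing C] [Algebra K C] [Algebra.FiniteType K C]
    (f : A →ₐ[K] B) (g : B →ₐ[K] C) : specMap g ≫ specMap f = specMap (g.comp f) := by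
  ext1
  exact (Spec.map_comp (CommRingCat.ofHom f.toRingHom) (CommRingCat.ofHom g.toRingHom)).symm

lemma motive_spec_congr (e : A ≃ₐ[K] B) : (spec K A).motive = (spec K B).motive :=
  motive_eq_of_iso ⟨specMap e.symm.toAlgHom, specMap e.toAlgHom,
    (specMap_comp _ _).trans ((congrArg specMap e.symm_comp).trans specMap_id),
    (specMap_comp _ _).trans ((congrArg specMap e.comp_symm).trans specMap_id)⟩

lemma motive_spec_self : (spec K K).motive = 1 := by
  rw [← motive_point]
  refine motive_eq_of_iso (Over.isoMk (Iso.refl _) ?_)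
  dsimp [spec, point]
  rw [Category.id_comp]
  exact (Spec.map_id _).symm

lemma motive_spec_polynomial_self : (spec K K[X]).motive = lefschetz K := rfl

instance : Algebra.FiniteType K (A ⊗[K] B) :=
  Algebra.FiniteType.trans (S := A) inferInstance inferInstance

lemma motive_spec_tensorProduct :
    (spec K (A ⊗[K] B)).motive = (spec K A).motive * (spec K B).motive := by
  rw [← motive_prod]
  refine motive_eq_of_iso (X := spec K (A ⊗[K] B)) (Y := (spec K A).prod (spec K B))
    (Over.isoMk (pullbackSpecIso K A B).symm ?_)
  have h : (pullbackSpecIso K A B).inv ≫ Limits.pullback.fst _ _ ≫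
      Spec.map (CommRingCat.ofHom (algebraMap K A)) =
      Spec.map (CommRingCat.ofHom (algebraMap K (A ⊗[K] B))) := by
    rw [pullbackSpecIso_inv_fst_assoc, ← Spec.map_comp, ← CommRingCat.ofHom_comp]
  exact h

lemma motive_spec_polynomial : (spec K A[X]).motive = lefschetz K * (spec K A).motive := by
  rw [motive_spec_congr (polyEquivTensor K A), motive_spec_tensorProduct,
    motive_spec_polynomial_self, mul_comm]

/-- The closed part is the zero locus of `f` and the open part its basic open set. -/
lemma isScissor_spec {C : Type u} [CommRing C] [Algebra K C] [Algebra.FiniteType K C] (f : A)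
    (g : A →ₐ[K] B) (hg : Function.Surjective g) (hf : RingHom.ker g = Ideal.span {f})
    [Algebra A C] [IsScalarTower K A C] [IsLocalization.Away f C] :
    IsScissor (spec K A) (spec K B) (spec K C) := by
  refine ⟨specMap g, specMap (IsScalarTower.toAlgHom K A C),
    IsClosedImmersion.spec_of_surjective _ hg, ?_, ?_⟩
  · exact IsOpenImmersion.of_isLocalization f
  · refine (PrimeSpectrum.localization_away_comap_range C f).trans ?_
    refine Eq.trans ?_ (congrArg compl (range_comap_of_surjective _ g.toRingHom hg).symm)
    have : RingHom.ker g.toRingHom = Ideal.span {f} := hf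
    rw [this, PrimeSpectrum.zeroLocus_span, PrimeSpectrum.basicOpen_eq_zeroLocus_compl]
    rfl

lemma motive_spec_scissor (f : A) :
    (spec K A).motive =
      (spec K (A ⧸ Ideal.span {f})).motive + (spec K (Localization.Away f)).motive :=
  (isScissor_spec f (Ideal.Quotient.mkₐ K (Ideal.span {f}))
    (Ideal.Quotient.mkₐ_surjective K _) (Ideal.Quotient.mkₐ_ker K _)).motive_eq

lemma motive_spec_of_subsingleton [Subsingleton A] : (spec K A).motive = 0 := by
  -- The empty scheme is both the closed and the open part of itself, so its class is twice itself.
  have h : IsScissor (spec K A) (spec K A) (spec K A) := by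
    have : IsLocalization.Away (0 : A) A :=
      IsLocalization.away_of_isUnit_of_bijective _ (isUnit_of_subsingleton (0 : A)) Function.bijective_id
    refine isScissor_spec (0 : A) (AlgHom.id K A) Function.surjective_id ?_
    exact Subsingleton.elim _ _
  simpa using h.motive_eq

end KVariety

/-! ### The coprime locus as the nonvanishing locus of the resultant -/

namespace MonicPairs

lemma noCommonRoot_eq_basicOpen (K : Type u) [Field K] (d₁ d₂ : ℕ) :
    noCommonRoot K d₁ d₂ = (PrimeSpectrum.basicOpen
      (Polynomial.resultant (univFst K d₁ d₂) (univSnd K d₁ d₂)) : Set _) := by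
  ext p
  set φ := algebraMap (CoeffRing K d₁ d₂) p.asIdeal.ResidueField with hφ
  have hu := univFst_monic K d₁ d₂
  have hv := univSnd_monic K d₁ d₂
  have h := Polynomial.isCoprime_iff_aeval_ne_zero_of_isAlgClosed
    (k := p.asIdeal.ResidueField) (AlgebraicClosure p.asIdeal.ResidueField)
    ((univFst K d₁ d₂).map φ) ((univSnd K d₁ d₂).map φ)
  rw [← Polynomial.isUnit_resultant_iff_isCoprime (hu.map φ), hu.natDegree_map φ,
    hv.natDegree_map φ, Polynomial.resultant_map_map, isUnit_iff_ne_zero, hφ, ne_eq,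
    Ideal.algebraMap_residueField_eq_zero] at h
  simp only [Polynomial.aeval_map_algebraMap] at h
  simp only [noCommonRoot, Set.mem_ofPred_eq, not_exists, not_and_or]
  exact h.symm

end MonicPairs

/-- The variety of coprime pairs is the spectrum of the localization at the resultant. -/
lemma motive_polyOne (K : Type u) [Field K] (d₁ d₂ : ℕ) :
    (polyOne K d₁ d₂).motive = (KVariety.spec K (Localization.Away (Polynomial.resultant
      (MonicPairs.univFst K d₁ d₂) (MonicPairs.univSnd K d₁ d₂)))).motive := by
  set f := Polynomial.resultant (MonicPairs.univFst K d₁ d₂) (MonicPairs.univSnd K d₁ d₂) with hf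
  -- Two open immersions into the same affine space with equal image have isomorphic sources.
  let j := Spec.map (CommRingCat.ofHom
    (algebraMap (MonicPairs.CoeffRing K d₁ d₂) (Localization.Away f)))
  have hj : IsOpenImmersion j := IsOpenImmersion.of_isLocalization f
  let i : (MonicPairs.locus K d₁ d₂ : Scheme.{u}) ⟶ _ := (MonicPairs.locus K d₁ d₂).ι
  have hi : IsOpenImmersion i := inferInstanceAs (IsOpenImmersion (MonicPairs.locus K d₁ d₂).ι)
  have hr : Set.range i = Set.range j := by
    refine (Scheme.Opens.range_ι _).trans ?_
    refine (MonicPairs.noCommonRoot_eq_basicOpen K d₁ d₂).trans ?_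
    exact (PrimeSpectrum.localization_away_comap_range (Localization.Away f) f).symm
  let e := IsOpenImmersion.isoOfRangeEq i j hr
  refine KVariety.motive_eq_of_iso (X := polyOne K d₁ d₂)
    (Y := KVariety.spec K (Localization.Away f))
    (Over.isoMk e ?_)
  have h : (KVariety.spec K (Localization.Away f)).toOver.hom = j ≫
      Spec.map (CommRingCat.ofHom (algebraMap K (MonicPairs.CoeffRing K d₁ d₂))) :=
    Spec.map_comp (CommRingCat.ofHom (algebraMap K (MonicPairs.CoeffRing K d₁ d₂)))
      (CommRingCat.ofHom (algebraMap (MonicPairs.CoeffRing K d₁ d₂) (Localization.Away f)))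
  rw [h]
  exact IsOpenImmersion.isoOfRangeEq_hom_fac_assoc i j hr _

/-- A condition on `ι`-tuples of elements of commutative `K`-algebras. -/
abbrev TuplePredicate (K : Type u) [Field K] (ι : Type*) :=
  ∀ (R : Type u) [CommRing R] [Algebra K R], (ι → R) → Prop

/-! ### Functors of points and their classes -/

section Represents

variable {K : Type u} [Field K] {ι κ : Type*}

variable (K) in
/-- The `K`-algebra `A`, with the universal tuple `x`, represents the functor of tuples
satisfying `C`. -/
def Represents {A : Type u} [CommRing A] [Algebra K A] (x : ι → A) (C : TuplePredicate K ι) :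
    Prop :=
  ∀ (R : Type u) [CommRing R] [Algebra K R],
    Set.BijOn (fun (φ : A →ₐ[K] R) i => φ (x i)) Set.univ {y | C R y}

namespace Represents

variable {A : Type u} [CommRing A] [Algebra K A] {B : Type u} [CommRing B] [Algebra K B]
  {x : ι → A} {C : TuplePredicate K ι} {D : TuplePredicate K κ}

lemma holds_map (h : Represents K x C) {R : Type u} [CommRing R] [Algebra K R] (φ : A →ₐ[K] R) :
    C R (fun i => φ (x i)) :=
  (h R).mapsTo (Set.mem_univ φ)

lemma holds (h : Represents K x C) : C A x := h.holds_map (AlgHom.id K A)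

lemma hom_ext (h : Represents K x C) {R : Type u} [CommRing R] [Algebra K R] {φ ψ : A →ₐ[K] R}
    (e : ∀ i, φ (x i) = ψ (x i)) : φ = ψ :=
  (h R).injOn (Set.mem_univ φ) (Set.mem_univ ψ) (funext e)

lemma exists_hom (h : Represents K x C) {R : Type u} [CommRing R] [Algebra K R] {y : ι → R}
    (hy : C R y) : ∃ φ : A →ₐ[K] R, ∀ i, φ (x i) = y i := by
  obtain ⟨φ, -, hφ⟩ := (h R).surjOn hy
  exact ⟨φ, congrFun hφ⟩

lemma of_exists_of_ext (holds : ∀ (R : Type u) [CommRing R] [Algebra K R] (φ : A →ₐ[K] R),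
      C R (fun i => φ (x i)))
    (exists_hom : ∀ (R : Type u) [CommRing R] [Algebra K R] (y : ι → R), C R y →
      ∃ φ : A →ₐ[K] R, ∀ i, φ (x i) = y i)
    (hom_ext : ∀ (R : Type u) [CommRing R] [Algebra K R] (φ ψ : A →ₐ[K] R),
      (∀ i, φ (x i) = ψ (x i)) → φ = ψ) : Represents K x C := by
  intro R _ _
  refine ⟨fun φ _ => holds R φ, fun φ _ ψ _ e => hom_ext R φ ψ (congrFun e), fun y hy => ?_⟩
  obtain ⟨φ, hφ⟩ := exists_hom R y hy
  exact ⟨φ, Set.mem_univ _, funext hφ⟩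

/-- Algebras representing the same functor are isomorphic. -/
lemma nonempty_algEquiv {x' : ι → B} (h : Represents K x C) (h' : Represents K x' C) :
    Nonempty (A ≃ₐ[K] B) := by
  obtain ⟨φ, hφ⟩ := h.exists_hom h'.holds
  obtain ⟨ψ, hψ⟩ := h'.exists_hom h.holds
  exact ⟨AlgEquiv.ofAlgHom φ ψ (h'.hom_ext fun i => by simp [hφ, hψ])
    (h.hom_ext fun i => by simp [hφ, hψ])⟩

/-- Transport of a representing algebra along a natural bijection of functors. -/
lemma congr (h : Represents K x C)
    (T : ∀ (R : Type u) [CommRing R] [Algebra K R], (ι → R) → (κ → R))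
    (T_map : ∀ (R S : Type u) [CommRing R] [Algebra K R] [CommRing S] [Algebra K S]
      (φ : R →ₐ[K] S) (y : ι → R), T S (fun i => φ (y i)) = fun i => φ (T R y i))
    (bij : ∀ (R : Type u) [CommRing R] [Algebra K R], Set.BijOn (T R) {y | C R y} {y | D R y}) :
    Represents K (T A x) D := by
  intro R _ _
  convert! (bij R).comp (h R) using 1
  funext φ
  exact (T_map A R φ x).symm

lemma away (f : MvPolynomial ι K) [Algebra (MvPolynomial ι K) A]
    [IsScalarTower K (MvPolynomial ι K) A] [IsLocalization.Away f A] :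
    Represents K (fun i => algebraMap (MvPolynomial ι K) A (MvPolynomial.X i))
      (fun _ _ _ y => IsUnit (MvPolynomial.aeval y f)) := by
  have key : ∀ (R : Type u) [CommRing R] [Algebra K R] (φ : A →ₐ[K] R),
      MvPolynomial.aeval (fun i => φ (algebraMap (MvPolynomial ι K) A (MvPolynomial.X i))) =
      φ.comp (IsScalarTower.toAlgHom K (MvPolynomial ι K) A) := by
    intro R _ _ φ
    ext i
    simp
  refine of_exists_of_ext (fun R _ _ φ => ?_) (fun R _ _ y hy => ?_) (fun R _ _ φ ψ e => ?_)
  · rw [key]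
    exact (IsLocalization.Away.algebraMap_isUnit (S := A) f).map φ
  · refine ⟨IsLocalization.liftAlgHom (M := Submonoid.powers f) (f := MvPolynomial.aeval y) ?_, ?_⟩
    · rintro ⟨_, n, rfl⟩
      simpa using hy.pow n
    · intro i
      simp
  · refine IsLocalization.algHom_ext (Submonoid.powers f) ?_
    exact MvPolynomial.algHom_ext e

/-- Together with `localization`, this describes both sides of the scissor relation for the function
`x i` through their points. -/
lemma quotient (h : Represents K x C) (i : ι) :
    Represents K (fun j => Ideal.Quotient.mkₐ K (Ideal.span {x i}) (x j))
      (fun R _ _ y => C R y ∧ y i = 0) := by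
  refine of_exists_of_ext (fun R _ _ φ => ⟨?_, ?_⟩) (fun R _ _ y hy => ?_)
    (fun R _ _ φ ψ e => ?_)
  · exact h.holds_map (φ.comp (Ideal.Quotient.mkₐ K (Ideal.span {x i})))
  · have : Ideal.Quotient.mkₐ K (Ideal.span {x i}) (x i) = 0 :=
      Ideal.Quotient.eq_zero_iff_mem.mpr (Ideal.mem_span_singleton_self _)
    exact (congrArg φ this).trans (map_zero φ)
  · obtain ⟨φ, hφ⟩ := h.exists_hom hy.1
    refine ⟨Ideal.Quotient.liftₐ _ φ fun a ha => ?_, fun j => ?_⟩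
    · obtain ⟨b, rfl⟩ := Ideal.mem_span_singleton'.mp ha
      rw [map_mul, hφ, hy.2, mul_zero]
    · exact hφ j
  · refine Ideal.Quotient.algHom_ext K ?_
    exact h.hom_ext e

lemma localization (h : Represents K x C) (i : ι) :
    Represents K (fun j => algebraMap A (Localization.Away (x i)) (x j))
      (fun R _ _ y => C R y ∧ IsUnit (y i)) := by
  refine of_exists_of_ext (fun R _ _ φ => ⟨?_, ?_⟩) (fun R _ _ y hy => ?_)
    (fun R _ _ φ ψ e => ?_)
  · exact h.holds_map (φ.comp (IsScalarTower.toAlgHom K A (Localization.Away (x i))))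
  · exact (IsLocalization.Away.algebraMap_isUnit (x i)).map φ
  · obtain ⟨φ, hφ⟩ := h.exists_hom hy.1
    refine ⟨IsLocalization.liftAlgHom (M := Submonoid.powers (x i)) (f := φ) ?_, fun j => ?_⟩
    · rintro ⟨_, n, rfl⟩
      simpa [hφ] using hy.2.pow n
    · simp [hφ]
  · refine IsLocalization.algHom_ext (Submonoid.powers (x i)) ?_
    exact h.hom_ext e

lemma polynomial (h : Represents K x C) :
    Represents K (fun o : Option ι => o.elim (Polynomial.X : A[X]) (fun i => Polynomial.C (x i)))
      (fun R _ _ y => C R (fun i => y (some i))) := by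
  refine of_exists_of_ext (fun R _ _ φ => ?_) (fun R _ _ y hy => ?_) (fun R _ _ φ ψ e => ?_)
  · exact h.holds_map (φ.comp Polynomial.CAlgHom)
  · obtain ⟨φ, hφ⟩ := h.exists_hom hy
    refine ⟨Polynomial.eval₂AlgHom φ (y none) fun _ => Commute.all _ _, ?_⟩
    rintro (_ | i)
    · simp
    · simp [hφ]
  · refine Polynomial.algHom_ext' (h.hom_ext fun i => e (some i)) (e none)

end Represents

/-- The functor of tuples satisfying `C` is represented by an affine `K`-variety of class `m`. -/
def HasMotive (C : TuplePredicate K ι) (m : K0Var K) : Prop :=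
  ∃ (A : Type u) (_ : CommRing A) (_ : Algebra K A) (_ : Algebra.FiniteType K A) (x : ι → A),
    Represents K x C ∧ (KVariety.spec K A).motive = m

namespace HasMotive

variable {C : TuplePredicate K ι} {D : TuplePredicate K κ} {m m' : K0Var K}

lemma unique (h : HasMotive C m) (h' : HasMotive C m') : m = m' := by
  obtain ⟨A, _, _, _, x, hx, rfl⟩ := h
  obtain ⟨B, _, _, _, y, hy, rfl⟩ := h'
  obtain ⟨e⟩ := hx.nonempty_algEquiv hy
  exact KVariety.motive_spec_congr e

/-- Naturally isomorphic functors have the same class. -/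
lemma congr (h : HasMotive C m)
    (T : ∀ (R : Type u) [CommRing R] [Algebra K R], (ι → R) → (κ → R))
    (T' : ∀ (R : Type u) [CommRing R] [Algebra K R], (κ → R) → (ι → R))
    (T_map : ∀ (R S : Type u) [CommRing R] [Algebra K R] [CommRing S] [Algebra K S]
      (φ : R →ₐ[K] S) (y : ι → R), T S (fun i => φ (y i)) = fun i => φ (T R y i))
    (mapsTo : ∀ (R : Type u) [CommRing R] [Algebra K R] (y : ι → R), C R y → D R (T R y))
    (mapsTo' : ∀ (R : Type u) [CommRing R] [Algebra K R] (y : κ → R), D R y → C R (T' R y))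
    (left_inv : ∀ (R : Type u) [CommRing R] [Algebra K R] (y : ι → R), C R y →
      T' R (T R y) = y)
    (right_inv : ∀ (R : Type u) [CommRing R] [Algebra K R] (y : κ → R), D R y →
      T R (T' R y) = y) :
    HasMotive D m := by
  obtain ⟨A, _, _, _, x, hx, rfl⟩ := h
  refine ⟨A, _, _, ‹_›, _, hx.congr T T_map fun R _ _ => ?_, rfl⟩
  exact Set.InvOn.bijOn ⟨left_inv R, right_inv R⟩ (mapsTo R) (mapsTo' R)

lemma exists_scissor (h : HasMotive C m) (i : ι) : ∃ m₁ m₂, m = m₁ + m₂ ∧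
    HasMotive (fun R _ _ y => C R y ∧ y i = 0) m₁ ∧
    HasMotive (fun R _ _ y => C R y ∧ IsUnit (y i)) m₂ := by
  obtain ⟨A, _, _, _, x, hx, rfl⟩ := h
  exact ⟨_, _, KVariety.motive_spec_scissor (x i),
    ⟨_, _, _, inferInstance, _, hx.quotient i, rfl⟩,
    ⟨_, _, _, inferInstance, _, hx.localization i, rfl⟩⟩

/-- The class of a product with the affine line. -/
lemma affineLine_prod (h : HasMotive C m) :
    HasMotive (fun R _ _ (y : Option ι → R) => C R (fun i => y (some i))) (lefschetz K * m) := by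
  obtain ⟨A, _, _, _, x, hx, rfl⟩ := h
  exact ⟨_, _, _, inferInstance, _, hx.polynomial, KVariety.motive_spec_polynomial⟩

/-- The class of a product with the punctured affine line. -/
lemma puncturedLine_prod (h : HasMotive C m) :
    HasMotive (fun R _ _ (y : Option ι → R) => C R (fun i => y (some i)) ∧ IsUnit (y none))
      ((lefschetz K - 1) * m) := by
  -- Cut the product with the line along its new coordinate; the zero section is a copy of the
  -- original functor.
  obtain ⟨m₁, m₂, hm, h₁, h₂⟩ := h.affineLine_prod.exists_scissor none
  have h₁' : HasMotive C m₁ :=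
    h₁.congr (fun R _ _ y i => y (some i)) (fun R _ _ y o => o.elim 0 y)
      (fun R S _ _ _ _ φ y => rfl) (fun R _ _ y hy => hy.1) (fun R _ _ y hy => ⟨hy, rfl⟩)
      (fun R _ _ y hy => by
        funext o
        cases o with
        | none => exact hy.2.symm
        | some i => rfl)
      (fun R _ _ y hy => rfl)
  obtain rfl := h₁'.unique h
  have : (lefschetz K - 1) * m₁ = m₂ := by rw [sub_mul, hm, one_mul, add_sub_cancel_left]
  rwa [this]

/-- The universal tuple itself satisfies `C`, so the representing algebra is the zero ring and the
variety is empty. -/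
lemma eq_zero (h : HasMotive C m)
    (hC : ∀ (R : Type u) [CommRing R] [Algebra K R] (y : ι → R), C R y → Subsingleton R) :
    m = 0 := by
  obtain ⟨A, _, _, _, x, hx, rfl⟩ := h
  have := hC A x hx.holds
  exact KVariety.motive_spec_of_subsingleton

lemma one_of_isEmpty [IsEmpty ι]
    (hC : ∀ (R : Type u) [CommRing R] [Algebra K R] (y : ι → R), C R y) :
    HasMotive C 1 := by
  refine ⟨K, _, _, inferInstance, isEmptyElim, ?_, KVariety.motive_spec_self⟩
  exact Represents.of_exists_of_ext (fun R _ _ φ => hC R _)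
    (fun R _ _ y hy => ⟨Algebra.ofId K R, isEmptyElim⟩)
    (fun R _ _ φ ψ _ => Subsingleton.elim _ _)

end HasMotive

end Represents

/-! ### Polynomials with prescribed coefficients -/

section TuplePolynomial

variable {R S : Type*} [CommRing R] [CommRing S] {n m : ℕ}

/-- The polynomial `y₀ + y₁ z + ⋯ + y_{n-1} z^{n-1}`. -/
def tuplePoly (y : Fin n → R) : R[X] := ∑ i, Polynomial.C (y i) * Polynomial.X ^ (i : ℕ)

/-- The monic polynomial `y₀ + y₁ z + ⋯ + y_{n-1} z^{n-1} + z^n`. -/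
def tupleMonic (y : Fin n → R) : R[X] := Polynomial.X ^ n + tuplePoly y

lemma tuplePoly_sub (y w : Fin n → R) : tuplePoly (y - w) = tuplePoly y - tuplePoly w := by
  simp [tuplePoly, sub_mul]

lemma tuplePoly_add (y w : Fin n → R) : tuplePoly (y + w) = tuplePoly y + tuplePoly w := by
  simp [tuplePoly, add_mul, Finset.sum_add_distrib]

lemma tuplePoly_smul (c : R) (y : Fin n → R) :
    tuplePoly (c • y) = Polynomial.C c * tuplePoly y := by
  simp [tuplePoly, Finset.mul_sum, mul_assoc]

lemma tuplePoly_snoc (y : Fin n → R) (c : R) :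
    tuplePoly (Fin.snoc y c : Fin (n + 1) → R) =
      tuplePoly y + Polynomial.C c * Polynomial.X ^ n := by
  simp [tuplePoly, Fin.sum_univ_castSucc]

lemma tupleMonic_monic (y : Fin n → R) : (tupleMonic y).Monic :=
  Polynomial.monic_X_pow_add (Polynomial.degree_sum_fin_lt _)

lemma natDegree_tupleMonic [Nontrivial R] (y : Fin n → R) : (tupleMonic y).natDegree = n :=
  Polynomial.natDegree_eq_of_degree_eq_some
    ((Polynomial.degree_add_eq_left_of_degree_lt ((Polynomial.degree_sum_fin_lt y).trans_eq
      (Polynomial.degree_X_pow n).symm)).trans (Polynomial.degree_X_pow n))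

lemma map_tupleMonic (φ : R →+* S) (y : Fin n → R) :
    (tupleMonic y).map φ = tupleMonic (fun i => φ (y i)) := by
  simp [tupleMonic, tuplePoly, Polynomial.map_sum]

/-- The non-leading coefficients of the product of `z^{m-n}` with a monic polynomial of degree
`n`. -/
def shiftTuple (m : ℕ) (y : Fin n → R) : Fin m → R :=
  fun i => (Polynomial.X ^ (m - n) * tupleMonic y).coeff i

lemma shiftTuple_map (φ : R →+* S) (y : Fin n → R) :
    shiftTuple m (fun i => φ (y i)) = fun i => φ (shiftTuple m y i) := by
  funext i
  rw [shiftTuple, shiftTuple, ← Polynomial.coeff_map, Polynomial.map_mul, map_tupleMonic,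
    Polynomial.map_pow, Polynomial.map_X]

lemma tupleMonic_shiftTuple (h : n ≤ m) (y : Fin n → R) :
    tupleMonic (shiftTuple m y) = Polynomial.X ^ (m - n) * tupleMonic y := by
  nontriviality R
  have hmon : (Polynomial.X ^ (m - n) * tupleMonic y).Monic :=
    (Polynomial.monic_X_pow _).mul (tupleMonic_monic y)
  have hdeg : (Polynomial.X ^ (m - n) * tupleMonic y).natDegree = m := by
    rw [(Polynomial.monic_X_pow _).natDegree_mul (tupleMonic_monic y),
      Polynomial.natDegree_X_pow, natDegree_tupleMonic, Nat.sub_add_cancel h]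
  conv_rhs => rw [hmon.as_sum, hdeg]
  rw [tupleMonic, tuplePoly, Finset.sum_range]
  rfl

end TuplePolynomial

/-! ### Euclidean division and the recursion for the classes -/

section Motives

variable (K : Type u) [Field K]

/-- Coprimality of the monic polynomials with given non-leading coefficients. -/
def CoprimeMonics (d₁ d₂ : ℕ) : TuplePredicate K (Fin d₁ ⊕ Fin d₂) := fun _ _ _ y =>
  IsCoprime (tupleMonic fun i => y (Sum.inl i)) (tupleMonic fun i => y (Sum.inr i))

/-- Coprimality of a monic polynomial of degree `n` and a polynomial of degree less than `k`. -/
def CoprimeRemainder (n k : ℕ) : TuplePredicate K (Fin n ⊕ Fin k) := fun _ _ _ y =>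
  IsCoprime (tupleMonic fun i => y (Sum.inl i)) (tuplePoly fun i => y (Sum.inr i))

lemma hasMotive_coprimeMonics (d₁ d₂ : ℕ) :
    HasMotive (CoprimeMonics K d₁ d₂) (polyOne K d₁ d₂).motive := by
  have h : CoprimeMonics K d₁ d₂ = (fun _ _ _ y => IsUnit (MvPolynomial.aeval y
      (Polynomial.resultant (MonicPairs.univFst K d₁ d₂) (MonicPairs.univSnd K d₁ d₂))) :
        TuplePredicate K (Fin d₁ ⊕ Fin d₂)) := by
    funext R _ _ y
    have hu : (MonicPairs.univFst K d₁ d₂).map (MvPolynomial.aeval y).toRingHom =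
        tupleMonic fun i => y (Sum.inl i) := by
      simp [MonicPairs.univFst, tupleMonic, tuplePoly, Polynomial.map_sum]
    have hv : (MonicPairs.univSnd K d₁ d₂).map (MvPolynomial.aeval y).toRingHom =
        tupleMonic fun i => y (Sum.inr i) := by
      simp [MonicPairs.univSnd, tupleMonic, tuplePoly, Polynomial.map_sum]
    -- Over the zero ring both conditions hold trivially, but monic polynomials lose their degree,
    -- so this case is treated apart.
    rcases subsingleton_or_nontrivial R with hR | hR
    · exact propext ⟨fun _ => isUnit_of_subsingleton _,
        fun _ => ⟨0, 0, Subsingleton.elim _ _⟩⟩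
    · rw [CoprimeMonics, ← hu, ← hv, ← Polynomial.isUnit_resultant_iff_isCoprime
        ((MonicPairs.univFst_monic K d₁ d₂).map _),
        (MonicPairs.univFst_monic K d₁ d₂).natDegree_map,
        (MonicPairs.univSnd_monic K d₁ d₂).natDegree_map, Polynomial.resultant_map_map]
      rfl
  rw [h, motive_polyOne]
  exact ⟨_, _, _, _, _, Represents.away _, rfl⟩

lemma motive_polyOne_comm (d₁ d₂ : ℕ) : (polyOne K d₁ d₂).motive = (polyOne K d₂ d₁).motive :=
  ((hasMotive_coprimeMonics K d₁ d₂).congr (fun R _ _ y i => y i.swap)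
    (fun R _ _ y i => y i.swap) (fun R S _ _ _ _ φ y => rfl)
    (fun R _ _ y hy => (show IsCoprime (tupleMonic _) (tupleMonic _) from hy).symm)
    (fun R _ _ y hy => (show IsCoprime (tupleMonic _) (tupleMonic _) from hy).symm)
    (fun R _ _ y hy => by simp) (fun R _ _ y hy => by simp)).unique
    (hasMotive_coprimeMonics K d₂ d₁)

variable {K}

/-- The map `(u, v) ↦ (v, u - z^(d₁-d₂) v)` only cancels the leading term of `u`. The new second
entry has degree below `d₁`, not necessarily below `d₂`, and coprimality with `v` is unchanged. -/
lemma hasMotive_coprimeRemainder {d₁ d₂ : ℕ} (h : d₂ ≤ d₁) :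
    HasMotive (CoprimeRemainder K d₂ d₁) (polyOne K d₁ d₂).motive := by
  refine (hasMotive_coprimeMonics K d₁ d₂).congr
    (fun R _ _ y => Sum.elim (fun i => y (Sum.inr i))
      ((fun i => y (Sum.inl i)) - shiftTuple d₁ fun i => y (Sum.inr i)))
    (fun R _ _ y => Sum.elim
      ((fun i => y (Sum.inr i)) + shiftTuple d₁ fun i => y (Sum.inl i)) (fun i => y (Sum.inl i)))
    (fun R S _ _ _ _ φ y => ?_) (fun R _ _ y hy => ?_) (fun R _ _ y hy => ?_)
    (fun R _ _ y hy => ?_) (fun R _ _ y hy => ?_)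
  · funext i
    have := congrFun (shiftTuple_map (m := d₁) φ.toRingHom fun i => y (Sum.inr i))
    cases i <;> simp_all
  · have e : tuplePoly ((fun i => y (Sum.inl i)) - shiftTuple d₁ fun i => y (Sum.inr i)) =
        tupleMonic (fun i => y (Sum.inl i)) +
          tupleMonic (fun i => y (Sum.inr i)) * (-Polynomial.X ^ (d₁ - d₂)) := by
      rw [mul_neg, mul_comm, ← tupleMonic_shiftTuple h, tuplePoly_sub, tupleMonic, tupleMonic]
      ring
    have := IsCoprime.add_mul_left_right (IsCoprime.symm hy) (-Polynomial.X ^ (d₁ - d₂))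
    rw [← e] at this
    exact this
  · have e : tupleMonic ((fun i => y (Sum.inr i)) + shiftTuple d₁ fun i => y (Sum.inl i)) =
        tuplePoly (fun i => y (Sum.inr i)) +
          tupleMonic (fun i => y (Sum.inl i)) * Polynomial.X ^ (d₁ - d₂) := by
      rw [mul_comm, ← tupleMonic_shiftTuple h, tupleMonic, tuplePoly_add, tupleMonic]
      ring
    have := (IsCoprime.add_mul_left_right hy (Polynomial.X ^ (d₁ - d₂))).symm
    rw [← e] at this
    exact this
  · funext i
    cases i <;> simp
  · funext i
    cases i <;> simp

/-- If `c` is the coefficient of `z^m` in `r`, then `r - c z^(m-n) v` has degree below `m` and is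
still coprime to `v`. The scalar `c` is unconstrained and supplies the affine line. -/
lemma motive_polyOne_succ {m n : ℕ} (h : n ≤ m) :
    (polyOne K (m + 1) n).motive = lefschetz K * (polyOne K m n).motive := by
  refine ((hasMotive_coprimeRemainder (K := K) (h.trans m.le_succ)).congr
    (D := fun R _ _ (y : Option (Fin n ⊕ Fin m) → R) =>
      CoprimeRemainder K n m R (fun i => y (some i)))
    (fun R _ _ y o => o.elim (y (Sum.inr (Fin.last m))) (Sum.elim (fun i => y (Sum.inl i))
      ((fun i => y (Sum.inr (Fin.castSucc i))) - y (Sum.inr (Fin.last m)) •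
        shiftTuple m fun i => y (Sum.inl i))))
    (fun R _ _ y => Sum.elim (fun i => y (some (Sum.inl i)))
      (Fin.snoc (α := fun _ => R) ((fun i => y (some (Sum.inr i))) +
        y none • shiftTuple m fun i => y (some (Sum.inl i))) (y none)))
    (fun R S _ _ _ _ φ y => ?_) (fun R _ _ y hy => ?_) (fun R _ _ y hy => ?_)
    (fun R _ _ y hy => ?_) (fun R _ _ y hy => ?_)).unique
    (hasMotive_coprimeRemainder h).affineLine_prod
  · funext i
    have := congrFun (shiftTuple_map (m := m) φ.toRingHom fun i => y (Sum.inl i))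
    rcases i with _ | i | i <;> simp_all
  · have e : tuplePoly ((fun i => y (Sum.inr (Fin.castSucc i))) - y (Sum.inr (Fin.last m)) •
        shiftTuple m fun i => y (Sum.inl i)) = tuplePoly (fun i => y (Sum.inr i)) +
        tupleMonic (fun i => y (Sum.inl i)) *
          (-(Polynomial.C (y (Sum.inr (Fin.last m))) * Polynomial.X ^ (m - n))) := by
      have : (fun i => y (Sum.inr i)) = (Fin.snoc (fun i => y (Sum.inr (Fin.castSucc i)))
          (y (Sum.inr (Fin.last m))) : Fin (m + 1) → R) :=
        (Fin.snoc_init_self fun i => y (Sum.inr i)).symm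
      rw [this, tuplePoly_sub, tuplePoly_smul, tuplePoly_snoc]
      have := tupleMonic_shiftTuple h fun i => y (Sum.inl i)
      rw [tupleMonic] at this
      linear_combination (Polynomial.C (y (Sum.inr (Fin.last m)))) * -this
    have := IsCoprime.add_mul_left_right hy
      (-(Polynomial.C (y (Sum.inr (Fin.last m))) * Polynomial.X ^ (m - n)))
    rw [← e] at this
    exact this
  · have e : tuplePoly (Fin.snoc ((fun i => y (some (Sum.inr i))) +
        y none • shiftTuple m fun i => y (some (Sum.inl i))) (y none) : Fin (m + 1) → R) =
        tuplePoly (fun i => y (some (Sum.inr i))) + tupleMonic (fun i => y (some (Sum.inl i))) *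
          (Polynomial.C (y none) * Polynomial.X ^ (m - n)) := by
      rw [tuplePoly_snoc, tuplePoly_add, tuplePoly_smul]
      have := tupleMonic_shiftTuple h fun i => y (some (Sum.inl i))
      rw [tupleMonic] at this
      linear_combination (Polynomial.C (y none)) * this
    have := IsCoprime.add_mul_left_right hy (Polynomial.C (y none) * Polynomial.X ^ (m - n))
    rw [← e] at this
    exact this
  · funext i
    rcases i with i | i
    · simp
    · cases i using Fin.lastCases <;> simp
  · funext i
    rcases i with _ | i | i <;> simp

/-- Scissors along the vanishing of the top coefficient of the remainder. -/
lemma HasMotive.coprimeRemainder_of_succ {n k : ℕ} {c : K0Var K}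
    (h : HasMotive (CoprimeRemainder K n (k + 1)) c) :
    HasMotive (CoprimeRemainder K n k) (c - (lefschetz K - 1) * (polyOne K n k).motive) := by
  obtain ⟨m₁, m₂, hm, h₁, h₂⟩ := h.exists_scissor (Sum.inr (Fin.last k))
  have h₂' : (lefschetz K - 1) * (polyOne K n k).motive = m₂ := by
    -- On the open part the remainder is uniquely a unit times a monic polynomial of degree `k`.
    -- `Ring.inverse` makes the inverse map total; its value matters only at units.
    refine ((hasMotive_coprimeMonics K n k).puncturedLine_prod.congr
      (fun R _ _ y => Sum.elim (fun i => y (some (Sum.inl i)))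
        (Fin.snoc (α := fun _ => R) (y none • fun i => y (some (Sum.inr i))) (y none)))
      (fun R _ _ y o => o.elim (y (Sum.inr (Fin.last k))) (Sum.elim (fun i => y (Sum.inl i))
        (Ring.inverse (y (Sum.inr (Fin.last k))) • fun i => y (Sum.inr (Fin.castSucc i)))))
      (fun R S _ _ _ _ φ y => ?_) (fun R _ _ y hy => ?_) (fun R _ _ y hy => ?_)
      (fun R _ _ y hy => ?_) (fun R _ _ y hy => ?_)).unique h₂
    · funext i
      rcases i with i | i
      · simp
      · cases i using Fin.lastCases <;> simp
    · obtain ⟨hy, hu⟩ := hy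
      refine ⟨?_, by simpa using hu⟩
      have e : tuplePoly (Fin.snoc (y none • fun i => y (some (Sum.inr i))) (y none) :
          Fin (k + 1) → R) = Polynomial.C (y none) *
            tupleMonic (fun i => y (some (Sum.inr i))) := by
        rw [tuplePoly_snoc, tuplePoly_smul, tupleMonic]
        ring
      have := (isCoprime_mul_unit_left_right (hu.map Polynomial.C) _ _).mpr hy
      rw [← e] at this
      exact this
    · obtain ⟨hy, hu⟩ := hy
      refine ⟨?_, hu⟩
      have e : tuplePoly (fun i => y (Sum.inr i)) = Polynomial.C (y (Sum.inr (Fin.last k))) *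
          tupleMonic (Ring.inverse (y (Sum.inr (Fin.last k))) •
            fun i => y (Sum.inr (Fin.castSucc i))) := by
        have : (fun i => y (Sum.inr i)) = (Fin.snoc (fun i => y (Sum.inr (Fin.castSucc i)))
            (y (Sum.inr (Fin.last k))) : Fin (k + 1) → R) :=
          (Fin.snoc_init_self fun i => y (Sum.inr i)).symm
        rw [this, tuplePoly_snoc, tupleMonic, tuplePoly_smul, mul_add, ← mul_assoc,
          ← Polynomial.C_mul, Ring.mul_inverse_cancel _ hu, Polynomial.C_1]
        ring
      have hy' := hy
      rw [CoprimeRemainder, e] at hy'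
      exact (isCoprime_mul_unit_left_right (hu.map Polynomial.C) _ _).mp hy'
    · funext i
      rcases i with _ | i | i <;> simp [← mul_assoc, Ring.inverse_mul_cancel _ hy.2]
    · funext i
      rcases i with i | i
      · simp
      · cases i using Fin.lastCases <;> simp [← mul_assoc, Ring.mul_inverse_cancel _ hy.2]
  have h₁' : HasMotive (CoprimeRemainder K n k) m₁ := by
    refine h₁.congr
      (fun R _ _ y => Sum.elim (fun i => y (Sum.inl i)) (fun i => y (Sum.inr (Fin.castSucc i))))
      (fun R _ _ y => Sum.elim (fun i => y (Sum.inl i))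
        (Fin.snoc (α := fun _ => R) (fun i => y (Sum.inr i)) 0))
      (fun R S _ _ _ _ φ y => ?_) (fun R _ _ y hy => ?_) (fun R _ _ y hy => ?_)
      (fun R _ _ y hy => ?_) (fun R _ _ y hy => ?_)
    · funext i
      cases i <;> simp
    · have : (fun i => y (Sum.inr i)) = (Fin.snoc (fun i => y (Sum.inr (Fin.castSucc i)))
            (y (Sum.inr (Fin.last k))) : Fin (k + 1) → R) :=
          (Fin.snoc_init_self fun i => y (Sum.inr i)).symm
      have hy' := hy.1
      rw [CoprimeRemainder, this, tuplePoly_snoc, hy.2, Polynomial.C_0, zero_mul, add_zero] at hy'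
      exact hy'
    · refine ⟨?_, by simp⟩
      have e := tuplePoly_snoc (fun i => y (Sum.inr i)) 0
      rw [Polynomial.C_0, zero_mul, add_zero] at e
      have hy' := hy
      rw [CoprimeRemainder, ← e] at hy'
      exact hy'
    · funext i
      rcases i with i | i
      · simp
      · cases i using Fin.lastCases <;> simp [hy.2]
    · funext i
      cases i <;> simp
  rwa [h₂', hm, add_sub_cancel_right]

/-- Removing the strata of top degree one after another leaves the zero remainder. That stratum is
empty: a monic polynomial coprime to `0` is a unit, hence `1`, which `0 < n` excludes over a nonzero
ring. -/
lemma HasMotive.coprimeRemainder_eq_sum {n : ℕ} (hn : 0 < n) {k : ℕ} {c : K0Var K}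
    (h : HasMotive (CoprimeRemainder K n k) c) :
    c = (lefschetz K - 1) * ∑ i ∈ Finset.range k, (polyOne K n i).motive := by
  induction k generalizing c with
  | zero =>
    rw [Finset.sum_range_zero, mul_zero]
    refine h.eq_zero fun R _ _ y hy => ?_
    have hu : IsUnit (tupleMonic fun i => y (Sum.inl i)) := by
      simpa [CoprimeRemainder, tuplePoly, isCoprime_zero_right] using hy
    by_contra hR
    rw [not_subsingleton_iff_nontrivial] at hR
    have := (tupleMonic_monic fun i => y (Sum.inl i)).eq_one_of_isUnit hu
    have := congrArg Polynomial.natDegree this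
    rw [natDegree_tupleMonic, Polynomial.natDegree_one] at this
    exact hn.ne' this
  | succ k ih =>
    rw [Finset.sum_range_succ, mul_add, ← ih h.coprimeRemainder_of_succ, sub_add_cancel]

/-! ### Solving the recursion -/

lemma motive_polyOne_zero_zero : (polyOne K 0 0).motive = 1 :=
  (hasMotive_coprimeMonics K 0 0).unique
    (HasMotive.one_of_isEmpty fun R _ _ y => by
      simp [CoprimeMonics, tupleMonic, tuplePoly, isCoprime_one_left])

lemma motive_polyOne_add (n j : ℕ) :
    (polyOne K (n + j) n).motive = lefschetz K ^ j * (polyOne K n n).motive := by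
  induction j with
  | zero => simp
  | succ j ih =>
    rw [← add_assoc, motive_polyOne_succ (Nat.le_add_right n j), ih, pow_succ', mul_assoc]

lemma motive_polyOne_right_zero (n : ℕ) : (polyOne K n 0).motive = lefschetz K ^ n := by
  simpa [motive_polyOne_zero_zero] using motive_polyOne_add (K := K) 0 n

lemma motive_polyOne_self (n : ℕ) :
    (polyOne K (n + 1) (n + 1)).motive = (lefschetz K - 1) * lefschetz K ^ (2 * n + 1) := by
  induction n using Nat.strong_induction_on with
  | _ n ih =>
    -- Telescoping: the term `i = 0` is `𝕃^(n+1)`, and by induction each term with `0 < i ≤ n` is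
    -- `𝕃^(n+1+i) - 𝕃^(n+i)`.
    have hsum : ∀ j ≤ n, ∑ i ∈ Finset.range (j + 1), (polyOne K (n + 1) i).motive =
        lefschetz K ^ (n + 1 + j) := by
      intro j hj
      induction j with
      | zero => simp [motive_polyOne_right_zero]
      | succ j hind =>
        -- The larger degree is rewritten as `(j+1) + (i+1)`, so that the new term is `𝕃^(i+1)`
        -- times the diagonal class at `j+1`, known by strong induction.
        obtain ⟨i, rfl⟩ := Nat.exists_eq_add_of_lt hj
        have : j + i + 1 + 1 = j + 1 + (i + 1) := by ring
        rw [Finset.sum_range_succ, hind (by omega), this, motive_polyOne_add,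
          ih j (by omega)]
        ring
    rw [(hasMotive_coprimeRemainder le_rfl).coprimeRemainder_eq_sum n.succ_pos, hsum n le_rfl]
    congr 2
    ring

lemma motive_polyOne_of_le {d₁ d₂ : ℕ} (h : d₂ ≤ d₁) (h₂ : 0 < d₂) :
    (polyOne K d₁ d₂).motive = lefschetz K ^ (d₁ + d₂) - lefschetz K ^ (d₁ + d₂ - 1) := by
  obtain ⟨j, rfl⟩ := Nat.exists_eq_add_of_le h
  obtain ⟨n, rfl⟩ := Nat.exists_eq_succ_of_ne_zero h₂.ne'
  have : n.succ + j + n.succ - 1 = j + (2 * n + 1) := by omega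
  rw [motive_polyOne_add, motive_polyOne_self, this, Nat.succ_eq_add_one]
  ring

end Motives

theorem proposition4p2 (K : Type u) [Field K] (d₁ d₂ : ℕ) :
    (0 < d₁ ∧ 0 < d₂ →
      (polyOne K d₁ d₂).motive = lefschetz K ^ (d₁ + d₂) - lefschetz K ^ (d₁ + d₂ - 1)) ∧
    (d₁ = 0 ∨ d₂ = 0 →
      (polyOne K d₁ d₂).motive = lefschetz K ^ (d₁ + d₂)) := by
  refine ⟨fun ⟨h₁, h₂⟩ => ?_, ?_⟩
  · rcases le_total d₂ d₁ with h | h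
    · exact motive_polyOne_of_le h h₂
    · rw [motive_polyOne_comm, add_comm]
      exact motive_polyOne_of_le h h₁
  · rintro (rfl | rfl)
    · rw [motive_polyOne_comm, motive_polyOne_right_zero, zero_add]
    · rw [motive_polyOne_right_zero, add_zero]

end
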